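/- Let $G$ be a group and $N$ a normal subgroup. A mixed commutator is an element $[g,w]=gwg^{-1}w^{-1}$ with $g\in G$, $w\in N$, and $[G,N]$ is the subgroup generated by the mixed commutators. For $x\in[G,N]$ let $\mathrm{cl}_{G,N}(x)$ be the least number of mixed commutators whose product is $x$, and let $\mathrm{scl}_{G,N}(x)=\lim_{m\to\infty}\mathrm{cl}_{G,N}(x^m)/m$ (this limit exists); put $\mathrm{scl}_G=\mathrm{scl}_{G,G}$. One says that $\mathrm{scl}_G$ and $\mathrm{scl}_{G,N}$ are equivalent if there is a real constant $C>0$ such that $\mathrm{scl}_{G,N}(x)\le C\cdot\mathrm{scl}_G(x)$ for every $x\in[G,N]$. Theorem. Let $\ell\ge 2$ be an integer, let $R_\ell=\langle a,b\mid [a,b]^\ell\rangle$, and let $R_\ell'=[R_\ell,R_\ell]$ be its commutator subgroup. Then $\mathrm{scl}_{R_\ell}$ and $\mathrm{scl}_{R_\ell,R_\ell'}$ are not equivalent. -/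

import Mathlib

open Filter Topology
open scoped commutatorElement

/-- `IsMixedCommutatorProduct N k x`: `x` is a product of exactly `k` mixed commutators
`⁅g, w⁆ = g * w * g⁻¹ * w⁻¹` with `g : G` and `w ∈ N`. -/
def IsMixedCommutatorProduct {G : Type*} [Group G] (N : Subgroup G) (k : ℕ) (x : G) : Prop :=
  ∃ L : List (G × N), L.length = k ∧ (L.map fun p => ⁅p.1, (p.2 : G)⁆).prod = x

/-- The mixed commutator length `cl_{G,N}(x)`, the least number of mixed commutators whose
product is `x`; meaningful for `x ∈ ⁅⊤, N⁆`, the mixed commutator subgroup `[G,N]`. -/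
noncomputable def mixedCommutatorLength {G : Type*} [Group G] (N : Subgroup G) (x : G) : ℕ :=
  sInf {k | IsMixedCommutatorProduct N k x}

/-- The stable mixed commutator length `scl_{G,N}(x) = lim_{m → ∞} cl_{G,N}(x ^ m) / m`;
meaningful for `x ∈ ⁅⊤, N⁆`, where the limit exists
(see `tendsto_stableMixedCommutatorLength`). -/
noncomputable def stableMixedCommutatorLength {G : Type*} [Group G] (N : Subgroup G) (x : G) : ℝ :=
  limUnder atTop fun m : ℕ => (mixedCommutatorLength N (x ^ m) : ℝ) / m

/-- The stable commutator length `scl_G`, i.e. the case `N = G`. -/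
noncomputable def stableCommutatorLength {G : Type*} [Group G] (x : G) : ℝ :=
  stableMixedCommutatorLength (⊤ : Subgroup G) x

/-- `scl_G` and `scl_{G,N}` are equivalent (on `[G,N]`): there is `C > 0` with
`scl_{G,N} ≤ C * scl_G` on `[G,N]`. -/
def SclEquivalent {G : Type*} [Group G] (N : Subgroup G) [N.Normal] : Prop :=
  ∃ C : ℝ, 0 < C ∧ ∀ x ∈ ⁅(⊤ : Subgroup G), N⁆,
    stableMixedCommutatorLength N x ≤ C * stableCommutatorLength x

/-- The one-relator group `R_ℓ = ⟨a, b | [a, b] ^ ℓ⟩`, with `a` and `b` the generators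
indexed by `0` and `1`. -/
abbrev OneRelatorGroup (ℓ : ℕ) : Type :=
  PresentedGroup ({⁅FreeGroup.of (0 : Fin 2), FreeGroup.of (1 : Fin 2)⁆ ^ ℓ} : Set (FreeGroup (Fin 2)))

theorem IsMixedCommutatorProduct.mul {G : Type*} [Group G] {N : Subgroup G} {j k : ℕ} {x y : G}
    (hx : IsMixedCommutatorProduct N j x) (hy : IsMixedCommutatorProduct N k y) :
    IsMixedCommutatorProduct N (j + k) (x * y) := by
  obtain ⟨L, rfl, rfl⟩ := hx
  obtain ⟨M, rfl, rfl⟩ := hy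
  exact ⟨L ++ M, by simp, by simp⟩

theorem IsMixedCommutatorProduct.inv {G : Type*} [Group G] {N : Subgroup G} [hN : N.Normal]
    {k : ℕ} {x : G} (hx : IsMixedCommutatorProduct N k x) :
    IsMixedCommutatorProduct N k x⁻¹ := by
  obtain ⟨L, rfl, rfl⟩ := hx
  induction L with
  | nil => exact ⟨[], rfl, by simp⟩
  | cons p L ih =>
    have h1 : IsMixedCommutatorProduct N 1 ⁅p.1, (p.2 : G)⁆⁻¹ :=
      ⟨[(p.1⁻¹, ⟨p.1 * p.2 * p.1⁻¹, hN.conj_mem _ p.2.2 _⟩)], rfl, by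
        simp only [List.map_cons, List.map_nil, List.prod_singleton, commutatorElement_def]
        group⟩
    simpa using ih.mul h1

/-- On the mixed commutator subgroup the mixed commutator length is attained. -/
theorem isMixedCommutatorProduct_mixedCommutatorLength {G : Type*} [Group G] (N : Subgroup G)
    [N.Normal] {x : G} (hx : x ∈ ⁅(⊤ : Subgroup G), N⁆) :
    IsMixedCommutatorProduct N (mixedCommutatorLength N x) x := by
  refine Nat.sInf_mem (s := {k | IsMixedCommutatorProduct N k x}) ?_
  change ∃ k, IsMixedCommutatorProduct N k x
  rw [Subgroup.commutator_def] at hx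
  induction hx using Subgroup.closure_induction with
  | mem x h =>
    obtain ⟨g, -, w, hw, rfl⟩ := h
    exact ⟨1, [(g, ⟨w, hw⟩)], rfl, by simp⟩
  | one => exact ⟨0, [], rfl, rfl⟩
  | mul x y _ _ hx hy =>
    obtain ⟨j, hj⟩ := hx
    obtain ⟨k, hk⟩ := hy
    exact ⟨_, hj.mul hk⟩
  | inv x _ hx =>
    obtain ⟨j, hj⟩ := hx
    exact ⟨_, hj.inv⟩

/-- The limit that defines the stable mixed commutator length exists on `[G,N]`. -/
theorem tendsto_stableMixedCommutatorLength {G : Type*} [Group G] (N : Subgroup G)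
    [N.Normal] {x : G} (hx : x ∈ ⁅(⊤ : Subgroup G), N⁆) :
    Tendsto (fun m : ℕ => (mixedCommutatorLength N (x ^ m) : ℝ) / m) atTop
      (𝓝 (stableMixedCommutatorLength N x)) := by
  have hsub : Subadditive fun m : ℕ => (mixedCommutatorLength N (x ^ m) : ℝ) := by
    intro m n
    simp only [pow_add]
    exact_mod_cast Nat.sInf_le
      ((isMixedCommutatorProduct_mixedCommutatorLength N (pow_mem hx m)).mul
        (isMixedCommutatorProduct_mixedCommutatorLength N (pow_mem hx n)))
  have hbdd : BddBelow (Set.range fun m : ℕ => (mixedCommutatorLength N (x ^ m) : ℝ) / m) :=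
    ⟨0, by rintro _ ⟨m, rfl⟩; positivity⟩
  exact tendsto_nhds_limUnder ⟨_, hsub.tendsto_lim hbdd⟩

/-! The witnesses are `x_n = ⁅a ^ n, b ^ ℓ⁆`. Each is one commutator, so its scl is at most 1; it
lies in `[R_ℓ, R_ℓ']` because `⁅a, b⁆` is central modulo that subgroup and has order dividing `ℓ`.
Their mixed scl is unbounded by a Bavard-type estimate: a function that is a quasimorphism on `R_ℓ'`
and bounded on mixed commutators bounds mixed scl below.

To build it, map the free group to the product of the Heisenberg group with lifts of circle
homeomorphisms `A`, `B` such that `⁅A, B⁆ ^ ℓ` is the unit translation. The relator goes to a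
central element, and the Heisenberg `z` minus `ℓ` times the displacement of 0 is invariant under it,
so descends to `R_ℓ`. On commutators the displacement is bounded, while `z` is a determinant: 0 on
mixed commutators, `n * ℓ` on `x_n`. -/

/-- A strictly increasing continuous function `h` with `h (c + 1) = h c + 1` restricts on
`[c, c + 1]` to a lift of an orientation preserving circle homeomorphism. -/
theorem exists_circleDeg1Lift_units_eqOn {h : ℝ → ℝ} (hm : StrictMono h) (hc : Continuous h)
    {c : ℝ} (hper : h (c + 1) = h c + 1) :
    ∃ u : CircleDeg1Liftˣ, ∀ x ∈ Set.Icc c (c + 1), (u : CircleDeg1Lift) x = h x := by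
  let H : ℝ → ℝ := fun x => h (x - ⌊x - c⌋) + ⌊x - c⌋
  have hlo (x : ℝ) : c ≤ x - ⌊x - c⌋ := by linarith [Int.floor_le (x - c)]
  have hhi (x : ℝ) : x - ⌊x - c⌋ < c + 1 := by linarith [Int.lt_floor_add_one (x - c)]
  have hH : StrictMono H := by
    intro x y hxy
    have hle : ⌊x - c⌋ ≤ ⌊y - c⌋ := Int.floor_le_floor (by linarith)
    rcases hle.eq_or_lt with he | hlt
    · have := hm (show x - ⌊x - c⌋ < y - ⌊y - c⌋ by rw [he]; linarith)
      simp only [H, he] at this ⊢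
      linarith
    · have h1 := hm (hhi x)
      have h2 := hm.monotone (hlo y)
      have h3 : (⌊x - c⌋ : ℝ) + 1 ≤ ⌊y - c⌋ := by exact_mod_cast hlt
      simp only [H]
      linarith
  have hadd (x : ℝ) (n : ℤ) : H (x + n) = H x + n := by
    have : ⌊x + n - c⌋ = ⌊x - c⌋ + n := by
      rw [show x + n - c = x - c + n by ring, Int.floor_add_intCast]
    simp only [H, this]
    push_cast
    rw [show x + n - (⌊x - c⌋ + n : ℝ) = x - ⌊x - c⌋ by ring]
    ring
  have hHh : ∀ x ∈ Set.Icc c (c + 1), H x = h x := by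
    rintro x ⟨h1, h2⟩
    rcases h2.eq_or_lt with rfl | h2
    · simp [H, hper]
    · have : ⌊x - c⌋ = 0 := Int.floor_eq_zero_iff.2 ⟨by linarith, by linarith⟩
      simp [H, this]
  have hsurj : Function.Surjective H := by
    intro y
    have hy : y - ⌊y - h c⌋ ∈ Set.Icc (h c) (h (c + 1)) :=
      ⟨by linarith [Int.floor_le (y - h c)], by linarith [Int.lt_floor_add_one (y - h c)]⟩
    obtain ⟨x, hx, hxy⟩ := intermediate_value_Icc (by linarith) hc.continuousOn hy
    refine ⟨x + ⌊y - h c⌋, ?_⟩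
    rw [hadd, hHh x hx, hxy]
    ring
  let f : CircleDeg1Lift := ⟨⟨H, hH.monotone⟩, fun x => by simpa using hadd x 1⟩
  have hf : IsUnit f := CircleDeg1Lift.isUnit_iff_bijective.2 ⟨hH.injective, hsurj⟩
  obtain ⟨u, hu⟩ := hf
  exact ⟨u, fun x hx => by rw [hu]; exact hHh x hx⟩

/-- Every rotation by `2 * s` with `0 < 2 * s ≤ 1 / 2` is a commutator of lifts of circle
homeomorphisms, which can be taken piecewise affine with two pieces per period. -/
theorem exists_circleDeg1Lift_commutator_eq_translate {s : ℝ} (hs : 0 < s) (hs' : s ≤ 1 / 4) :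
    ∃ A B : CircleDeg1Liftˣ, ⁅A, B⁆ = CircleDeg1Lift.translate (Multiplicative.ofAdd (2 * s)) := by
  have min_affine_strictMono {m d m' d' : ℝ} (h : 0 < m) (h' : 0 < m') :
      StrictMono fun x : ℝ => min (m * x + d) (m' * x + d') := fun x y hxy =>
    min_lt_min (by simpa using mul_lt_mul_of_pos_left hxy h)
      (by simpa using mul_lt_mul_of_pos_left hxy h')
  have hk : 0 < 1 - 16 * s / 5 := by linarith
  -- Modulo 1, `A` breaks at 0 and 1/8, which `B` fixes; `B` breaks at -7/48 and 1/48, which `A`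
  -- fixes. The bound on `s` keeps both slopes of `B` positive.
  obtain ⟨A, hA⟩ := exists_circleDeg1Lift_units_eqOn (c := 0)
    (h := fun t => min (7 * t + (-1 / 8)) (1 / 7 * t + 41 / 56))
    (min_affine_strictMono (by norm_num) (by norm_num))
    (by fun_prop) (by norm_num)
  obtain ⟨B, hB⟩ := exists_circleDeg1Lift_units_eqOn (c := -7 / 48)
    (h := fun t => min ((1 + 16 * s) * t + 0) ((1 - 16 * s / 5) * t + 2 * s / 5))
    (min_affine_strictMono (by linarith) hk)
    (by fun_prop) (by
      rw [min_eq_right (by linarith), min_eq_left (by linarith)]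
      ring)
  have hA1 (t : ℝ) (h0 : 0 ≤ t) (h1 : t ≤ 1 / 8) : (A : CircleDeg1Lift) t = 7 * t - 1 / 8 := by
    rw [hA t ⟨h0, by linarith⟩, min_eq_left (by linarith)]
    ring
  have hA2 (t : ℝ) (h0 : 1 / 8 ≤ t) (h1 : t ≤ 1) :
      (A : CircleDeg1Lift) t = 1 / 7 * t + 41 / 56 := by
    rw [hA t ⟨by linarith, by linarith⟩, min_eq_right (by linarith)]
  have hB1 (t : ℝ) (h0 : -7 / 48 ≤ t) (h1 : t ≤ 1 / 48) :
      (B : CircleDeg1Lift) t = (1 + 16 * s) * t := by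
    rw [hB t ⟨h0, by linarith⟩, min_eq_left (by nlinarith)]
    ring
  have hB2 (t : ℝ) (h0 : 1 / 48 ≤ t) (h1 : t ≤ 41 / 48) :
      (B : CircleDeg1Lift) t = (1 - 16 * s / 5) * t + 2 * s / 5 := by
    rw [hB t ⟨by linarith, by linarith⟩, min_eq_right (by nlinarith)]
  have hA2' (t : ℝ) (h0 : -7 / 8 ≤ t) (h1 : t ≤ 0) :
      (A : CircleDeg1Lift) t = 1 / 7 * t - 1 / 8 := by
    have := (A : CircleDeg1Lift).map_add_one t
    rw [hA2 (t + 1) (by linarith) (by linarith)] at this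
    linarith
  -- Each map preserves the arcs on which the other is affine, so `AB` and `BA` have equal slopes
  -- and differ by a constant. At 0 it is `-1/8 - B(-1/8) = 2 * s`.
  have key (t : ℝ) (h0 : -7 / 48 ≤ t) (h1 : t ≤ 41 / 48) :
      (A : CircleDeg1Lift) ((B : CircleDeg1Lift) t) =
        2 * s + (B : CircleDeg1Lift) ((A : CircleDeg1Lift) t) := by
    rcases le_total t 0 with ht | ht
    · rw [hB1 t h0 (by linarith), hA2' t (by linarith) ht, hB1 _ (by linarith) (by linarith),
        hA2' _ (by nlinarith) (by nlinarith)]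
      ring
    rcases le_total t (1 / 48) with ht1 | ht1
    · rw [hB1 t h0 ht1, hA1 t ht (by linarith), hB1 _ (by linarith) (by linarith),
        hA1 _ (by positivity) (by nlinarith)]
      ring
    rcases le_total t (1 / 8) with ht2 | ht2
    · rw [hB2 t ht1 h1, hA1 t ht ht2, hB2 _ (by linarith) (by linarith),
        hA1 _ (by nlinarith) (by nlinarith)]
      ring
    · rw [hB2 t ht1 h1, hA2 t ht2 (by linarith), hB2 _ (by linarith) (by linarith),
        hA2 _ (by nlinarith) (by nlinarith)]
      ring
  refine ⟨A, B, ?_⟩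
  rw [commutatorElement_def, mul_inv_eq_iff_eq_mul, mul_inv_eq_iff_eq_mul]
  ext t
  simp only [Units.val_mul, CircleDeg1Lift.mul_apply, CircleDeg1Lift.translate_apply]
  set n : ℤ := ⌊t + 7 / 48⌋ with hn
  have h1 := Int.floor_le (t + 7 / 48)
  have h2 := Int.lt_floor_add_one (t + 7 / 48)
  have := key (t - n) (by linarith) (by linarith)
  simp only [CircleDeg1Lift.map_sub_int] at this
  linarith

theorem exists_circleDeg1Lift_commutator_pow_eq_translate {ℓ : ℕ} (hℓ : 2 ≤ ℓ) :
    ∃ A B : CircleDeg1Liftˣ,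
      ⁅A, B⁆ ^ ℓ = CircleDeg1Lift.translate (Multiplicative.ofAdd 1) := by
  have h2 : (2 : ℝ) ≤ ℓ := by exact_mod_cast hℓ
  obtain ⟨A, B, h⟩ := exists_circleDeg1Lift_commutator_eq_translate
    (s := 1 / (2 * ℓ)) (by positivity) (by
      rw [div_le_div_iff₀ (by positivity) (by norm_num)]
      linarith)
  refine ⟨A, B, ?_⟩
  rw [h, ← map_pow, ← ofAdd_nsmul]
  congr 2
  rw [nsmul_eq_mul]
  field_simp

/-! ### Quasimorphisms and lower bounds for mixed scl -/

section QuasimorphismBound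

variable {G : Type*} [Group G] {N : Subgroup G} {f : G → ℝ} {D K : ℝ}

theorem abs_le_of_isMixedCommutatorProduct [N.Normal]
    (hD : ∀ v ∈ N, ∀ w ∈ N, |f (v * w) - f v - f w| ≤ D)
    (hK : ∀ g : G, ∀ w ∈ N, |f ⁅g, w⁆| ≤ K) {k : ℕ} {x : G}
    (hx : IsMixedCommutatorProduct N k x) : |f x| ≤ k * (K + D) + D := by
  obtain ⟨L, rfl, rfl⟩ := hx
  suffices h : (L.map fun p => ⁅p.1, (p.2 : G)⁆).prod ∈ N ∧
      |f (L.map fun p => ⁅p.1, (p.2 : G)⁆).prod| ≤ L.length * (K + D) + D from h.2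
  induction L with
  | nil =>
    refine ⟨one_mem N, ?_⟩
    -- The defect at `(1, 1)` is `|f 1|`; this is the final `+ D` of the bound.
    have := hD 1 (one_mem N) 1 (one_mem N)
    simpa using this
  | cons p L ih =>
    obtain ⟨hmem, hle⟩ := ih
    have hp : ⁅p.1, (p.2 : G)⁆ ∈ N :=
      mul_mem (Subgroup.Normal.conj_mem inferInstance _ p.2.2 _) (inv_mem p.2.2)
    simp only [List.map_cons, List.prod_cons, List.length_cons, Nat.cast_add, Nat.cast_one]
    refine ⟨mul_mem hp hmem, ?_⟩
    have h1 := hD _ hp _ hmem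
    have h2 := hK p.1 p.2 p.2.2
    rw [abs_le] at *
    constructor <;> linarith

theorem abs_map_pow_sub_le (hD : ∀ v ∈ N, ∀ w ∈ N, |f (v * w) - f v - f w| ≤ D) {x : G}
    (hx : x ∈ N) (m : ℕ) : |f (x ^ m) - m * f x| ≤ (m + 1) * D := by
  induction m with
  | zero => simpa using hD 1 (one_mem N) 1 (one_mem N)
  | succ m ih =>
    have := hD _ (pow_mem hx m) _ hx
    rw [pow_succ]
    push_cast
    rw [abs_le] at *
    constructor <;> linarith

/-- A function that is a quasimorphism on `N` and bounded on mixed commutators bounds the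
stable mixed commutator length from below. -/
theorem abs_sub_le_mul_stableMixedCommutatorLength [N.Normal]
    (hD : ∀ v ∈ N, ∀ w ∈ N, |f (v * w) - f v - f w| ≤ D)
    (hK : ∀ g : G, ∀ w ∈ N, |f ⁅g, w⁆| ≤ K) {x : G} (hx : x ∈ ⁅(⊤ : Subgroup G), N⁆) :
    |f x| - D ≤ stableMixedCommutatorLength N x * (K + D) := by
  have hxN : x ∈ N := Subgroup.commutator_le_right _ _ hx
  have hlim := ((tendsto_stableMixedCommutatorLength N hx).mul_const (K + D)).add
    (tendsto_const_div_atTop_nhds_zero_nat (2 * D))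
  rw [add_zero] at hlim
  refine ge_of_tendsto hlim ?_
  filter_upwards [eventually_gt_atTop 0] with m hm
  have hm' : (0 : ℝ) < m := by exact_mod_cast hm
  have h1 := abs_le_of_isMixedCommutatorProduct hD hK
    (isMixedCommutatorProduct_mixedCommutatorLength N (pow_mem hx m))
  have h2 := abs_map_pow_sub_le hD hxN m
  have h3 : m * |f x| ≤ |f (x ^ m)| + |f (x ^ m) - m * f x| := by
    rw [← Nat.abs_cast m, ← abs_mul, Nat.abs_cast, abs_sub_comm]
    simpa using abs_add_le (f (x ^ m)) (m * f x - f (x ^ m))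
  rw [div_mul_eq_mul_div, ← add_div, le_div_iff₀ hm']
  linarith

theorem stableCommutatorLength_commutatorElement_le_one (g h : G) :
    stableCommutatorLength ⁅g, h⁆ ≤ 1 := by
  have hmem : ⁅g, h⁆ ∈ ⁅(⊤ : Subgroup G), (⊤ : Subgroup G)⁆ :=
    Subgroup.commutator_mem_commutator trivial trivial
  refine le_of_tendsto (tendsto_stableMixedCommutatorLength ⊤ hmem) (.of_forall fun m => ?_)
  refine div_le_one_of_le₀ ?_ (Nat.cast_nonneg m)
  have h : IsMixedCommutatorProduct ⊤ m (⁅g, h⁆ ^ m) :=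
    ⟨List.replicate m (g, ⟨h, trivial⟩), by simp, by simp⟩
  exact_mod_cast Nat.sInf_le h

end QuasimorphismBound

theorem abs_circleDeg1Lift_mul_zero_sub_le (u v : CircleDeg1Liftˣ) :
    |(u * v) 0 - u 0 - v 0| ≤ 1 := by
  have h1 := (u : CircleDeg1Lift).map_map_zero_lt v
  have h2 := (u : CircleDeg1Lift).lt_map_map_zero v
  rw [Units.val_mul, CircleDeg1Lift.mul_apply, abs_le]
  constructor <;> linarith

/-- Since `⁅u, v⁆ * (v * u) = u * v`, three uses of the defect bound 1 suffice. -/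
theorem abs_circleDeg1Lift_commutator_zero_le (u v : CircleDeg1Liftˣ) : |⁅u, v⁆ 0| ≤ 3 := by
  have h1 := abs_circleDeg1Lift_mul_zero_sub_le ⁅u, v⁆ (v * u)
  have h2 := abs_circleDeg1Lift_mul_zero_sub_le u v
  have h3 := abs_circleDeg1Lift_mul_zero_sub_le v u
  rw [show ⁅u, v⁆ * (v * u) = u * v by rw [commutatorElement_def]; group] at h1
  rw [abs_le] at *
  constructor <;> linarith

/-! ### The Heisenberg group and the invariant defect function -/

/-- The integral Heisenberg group. -/
@[ext]
structure HeisenbergGroup where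
  /-- The first coordinate of the abelianization. -/
  x : ℤ
  /-- The second coordinate of the abelianization. -/
  y : ℤ
  /-- The central coordinate. -/
  z : ℤ

namespace HeisenbergGroup

instance : Mul HeisenbergGroup := ⟨fun u v => ⟨u.x + v.x, u.y + v.y, u.z + v.z + u.x * v.y⟩⟩

instance : One HeisenbergGroup := ⟨⟨0, 0, 0⟩⟩

instance : Inv HeisenbergGroup := ⟨fun u => ⟨-u.x, -u.y, -u.z + u.x * u.y⟩⟩

@[simp] theorem mul_x (u v : HeisenbergGroup) : (u * v).x = u.x + v.x := rfl
@[simp] theorem mul_y (u v : HeisenbergGroup) : (u * v).y = u.y + v.y := rfl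
@[simp] theorem mul_z (u v : HeisenbergGroup) : (u * v).z = u.z + v.z + u.x * v.y := rfl
@[simp] theorem one_x : (1 : HeisenbergGroup).x = 0 := rfl
@[simp] theorem one_y : (1 : HeisenbergGroup).y = 0 := rfl
@[simp] theorem one_z : (1 : HeisenbergGroup).z = 0 := rfl
@[simp] theorem inv_x (u : HeisenbergGroup) : u⁻¹.x = -u.x := rfl
@[simp] theorem inv_y (u : HeisenbergGroup) : u⁻¹.y = -u.y := rfl
@[simp] theorem inv_z (u : HeisenbergGroup) : u⁻¹.z = -u.z + u.x * u.y := rfl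

instance : Group HeisenbergGroup :=
  Group.ofLeftAxioms (fun u v w => by ext <;> simp <;> ring) (fun u => by ext <;> simp)
    (fun u => by ext <;> simp)

theorem commutatorElement_eq (u v : HeisenbergGroup) :
    ⁅u, v⁆ = ⟨0, 0, u.x * v.y - v.x * u.y⟩ := by
  ext <;> simp [commutatorElement_def]; ring

theorem pow_x (u : HeisenbergGroup) (n : ℕ) : (u ^ n).x = n * u.x := by
  induction n with
  | zero => simp
  | succ n ih => simp [pow_succ, ih]; ring

theorem pow_y (u : HeisenbergGroup) (n : ℕ) : (u ^ n).y = n * u.y := by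
  induction n with
  | zero => simp
  | succ n ih => simp [pow_succ, ih]; ring

theorem central_pow (k : ℤ) (n : ℕ) : (⟨0, 0, k⟩ : HeisenbergGroup) ^ n = ⟨0, 0, n * k⟩ := by
  induction n with
  | zero => ext <;> simp
  | succ n ih => rw [pow_succ, ih]; ext <;> simp; ring

theorem x_eq_zero_and_y_eq_zero_of_mem_commutator {u : HeisenbergGroup}
    (hu : u ∈ commutator HeisenbergGroup) : u.x = 0 ∧ u.y = 0 := by
  rw [commutator_eq_closure] at hu
  induction hu using Subgroup.closure_induction with
  | mem u h =>
    obtain ⟨v, w, rfl⟩ := h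
    simp [commutatorElement_eq]
  | one => simp
  | mul u v _ _ hu hv => simp [hu, hv]
  | inv u _ hu => simp [hu]

end HeisenbergGroup

/-- On `HeisenbergGroup × CircleDeg1Liftˣ`, the central coordinate minus `ℓ` times the
displacement of `0`. It is invariant under the central element that combines the `ℓ`-th power of
the Heisenberg centre with the unit translation. -/
noncomputable def heisenbergCircleDefect (ℓ : ℕ) (p : HeisenbergGroup × CircleDeg1Liftˣ) : ℝ :=
  p.1.z - ℓ * p.2 0

/-- The cocycle `u.x * v.y` vanishes when the left factor has `x = 0`, so only the displacement
fails to be additive. -/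
theorem heisenbergCircleDefect_mul_le (ℓ : ℕ) (p q : HeisenbergGroup × CircleDeg1Liftˣ)
    (hp : p.1.x = 0) :
    |heisenbergCircleDefect ℓ (p * q) - heisenbergCircleDefect ℓ p -
      heisenbergCircleDefect ℓ q| ≤ ℓ := by
  have h := abs_circleDeg1Lift_mul_zero_sub_le p.2 q.2
  simp only [heisenbergCircleDefect, Prod.fst_mul, Prod.snd_mul, HeisenbergGroup.mul_z, hp,
    Int.cast_add, Int.cast_mul, Int.cast_zero]
  rw [show (p.1.z + q.1.z + (0 : ℝ) * q.1.y - ℓ * (p.2 * q.2) 0 - (p.1.z - ℓ * p.2 0) -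
      (q.1.z - ℓ * q.2 0) : ℝ) = -(ℓ * ((p.2 * q.2) 0 - p.2 0 - q.2 0)) by ring, abs_neg, abs_mul,
    Nat.abs_cast]
  exact mul_le_of_le_one_right (Nat.cast_nonneg ℓ) h

theorem heisenbergCircleDefect_commutator_sub_le (ℓ : ℕ) (p q : HeisenbergGroup × CircleDeg1Liftˣ) :
    |heisenbergCircleDefect ℓ ⁅p, q⁆ - (p.1.x * q.1.y - q.1.x * p.1.y : ℤ)| ≤ ℓ * 3 := by
  have h := abs_circleDeg1Lift_commutator_zero_le p.2 q.2
  have h1 : ⁅p, q⁆.1 = ⁅p.1, q.1⁆ := rfl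
  have h2 : ⁅p, q⁆.2 = ⁅p.2, q.2⁆ := rfl
  rw [heisenbergCircleDefect, h1, h2, HeisenbergGroup.commutatorElement_eq, sub_sub_cancel_left,
    abs_neg, abs_mul, Nat.abs_cast]
  exact mul_le_mul_of_nonneg_left h (Nat.cast_nonneg ℓ)

/-- The generator adds `ℓ` to `z` and 1 to the displacement, and these cancel. -/
theorem heisenbergCircleDefect_mul_of_mem_zpowers {ℓ : ℕ}
    (p : HeisenbergGroup × CircleDeg1Liftˣ) {q : HeisenbergGroup × CircleDeg1Liftˣ}
    (hq : q ∈ Subgroup.zpowers ((⟨0, 0, ℓ⟩, CircleDeg1Lift.translate (Multiplicative.ofAdd 1)) :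
      HeisenbergGroup × CircleDeg1Liftˣ)) :
    heisenbergCircleDefect ℓ (p * q) = heisenbergCircleDefect ℓ p := by
  have key (p : HeisenbergGroup × CircleDeg1Liftˣ) :
      heisenbergCircleDefect ℓ (p * (⟨0, 0, ℓ⟩, CircleDeg1Lift.translate (Multiplicative.ofAdd 1)))
        = heisenbergCircleDefect ℓ p := by
    have := (p.2 : CircleDeg1Lift).map_add_one 0
    rw [zero_add] at this
    simp only [heisenbergCircleDefect, Prod.fst_mul, Prod.snd_mul, HeisenbergGroup.mul_z,
      Units.val_mul, CircleDeg1Lift.mul_apply, CircleDeg1Lift.translate_apply, add_zero, this]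
    push_cast
    ring
  rw [Subgroup.zpowers_eq_closure] at hq
  induction hq using Subgroup.closure_induction generalizing p with
  | mem q h => rw [Set.mem_singleton_iff.1 h, key]
  | one => rw [mul_one]
  | mul q r _ _ hq hr => rw [← mul_assoc, hr, hq]
  | inv q _ hq => rw [← hq (p * q⁻¹), inv_mul_cancel_right]

/-- `R_ℓ` carries a function that is quasi-additive on the commutator subgroup, bounded on mixed
commutators, and unbounded on the commutators `⁅a ^ n, b ^ ℓ⁆`. -/
theorem exists_quasimorphism_oneRelatorGroup {ℓ : ℕ} (hℓ : 2 ≤ ℓ) :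
    ∃ f : OneRelatorGroup ℓ → ℝ,
      (∀ v ∈ commutator (OneRelatorGroup ℓ), ∀ w ∈ commutator (OneRelatorGroup ℓ),
        |f (v * w) - f v - f w| ≤ ℓ) ∧
      (∀ g : OneRelatorGroup ℓ, ∀ w ∈ commutator (OneRelatorGroup ℓ), |f ⁅g, w⁆| ≤ ℓ * 3) ∧
      ∀ n : ℕ, |f ⁅(PresentedGroup.of 0 : OneRelatorGroup ℓ) ^ n,
        (PresentedGroup.of 1 : OneRelatorGroup ℓ) ^ ℓ⁆ - n * ℓ| ≤ ℓ * 3 := by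
  obtain ⟨A, B, hAB⟩ := exists_circleDeg1Lift_commutator_pow_eq_translate hℓ
  set ζ : HeisenbergGroup × CircleDeg1Liftˣ :=
    (⟨0, 0, ℓ⟩, CircleDeg1Lift.translate (Multiplicative.ofAdd 1)) with hζ
  let Φ : FreeGroup (Fin 2) →* HeisenbergGroup × CircleDeg1Liftˣ :=
    FreeGroup.lift ![((⟨1, 0, 0⟩ : HeisenbergGroup), A), (⟨0, 1, 0⟩, B)]
  have hΦ0 : Φ (.of 0) = (⟨1, 0, 0⟩, A) := by simp [Φ]
  have hΦ1 : Φ (.of 1) = (⟨0, 1, 0⟩, B) := by simp [Φ]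
  have hrel : Φ (⁅FreeGroup.of (0 : Fin 2), FreeGroup.of (1 : Fin 2)⁆ ^ ℓ) = ζ := by
    rw [map_pow, map_commutatorElement, hΦ0, hΦ1]
    refine Prod.ext ?_ hAB
    change ⁅(⟨1, 0, 0⟩ : HeisenbergGroup), (⟨0, 1, 0⟩ : HeisenbergGroup)⁆ ^ ℓ = ⟨0, 0, ℓ⟩
    rw [HeisenbergGroup.commutatorElement_eq, HeisenbergGroup.central_pow]
    simp
  have hcentral : ζ ∈ Subgroup.center (HeisenbergGroup × CircleDeg1Liftˣ) := by
    rw [Subgroup.mem_center_iff]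
    intro p
    refine Prod.ext ?_ ?_
    · ext <;> simp [hζ, add_comm]
    · ext t
      simp [hζ]
  have hnormal : (Subgroup.zpowers ζ).Normal :=
    ⟨fun q hq g => by
      have hqc : q ∈ Subgroup.center _ := Subgroup.zpowers_le.2 hcentral hq
      rw [Subgroup.mem_center_iff.1 hqc g, mul_inv_cancel_right]
      exact hq⟩
  let mk : FreeGroup (Fin 2) →* OneRelatorGroup ℓ := PresentedGroup.mk _
  have hmk : Function.Surjective mk := PresentedGroup.mk_surjective _
  have hker {x y : FreeGroup (Fin 2)} (h : mk x = mk y) : Φ (x⁻¹ * y) ∈ Subgroup.zpowers ζ := by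
    have hle : Subgroup.normalClosure
        {⁅FreeGroup.of (0 : Fin 2), FreeGroup.of (1 : Fin 2)⁆ ^ ℓ} ≤
          (Subgroup.zpowers ζ).comap Φ := by
      refine Subgroup.normalClosure_le_normal ?_
      rw [Set.singleton_subset_iff, SetLike.mem_coe, Subgroup.mem_comap, hrel]
      exact Subgroup.mem_zpowers ζ
    exact hle (QuotientGroup.eq.1 h)
  -- The section is arbitrary: two lifts differ under `Φ` by a power of `ζ`, which the defect
  -- ignores.
  let f : OneRelatorGroup ℓ → ℝ := fun g =>
    heisenbergCircleDefect ℓ (Φ (Function.surjInv hmk g))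
  have hf (x : FreeGroup (Fin 2)) : f (mk x) = heisenbergCircleDefect ℓ (Φ x) := by
    have h := heisenbergCircleDefect_mul_of_mem_zpowers (Φ x)
      (hker (Function.surjInv_eq hmk (mk x)).symm)
    rw [← map_mul, mul_inv_cancel_left] at h
    exact h
  -- Lifts taken inside the free commutator subgroup have trivial Heisenberg abelianization.
  have hlift {w : OneRelatorGroup ℓ} (hw : w ∈ commutator (OneRelatorGroup ℓ)) :
      ∃ x, mk x = w ∧ (Φ x).1.x = 0 ∧ (Φ x).1.y = 0 := by
    have hmap : (commutator (FreeGroup (Fin 2))).map mk = commutator (OneRelatorGroup ℓ) := by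
      rw [commutator_def, commutator_def, Subgroup.map_commutator,
        Subgroup.map_top_of_surjective mk hmk]
    rw [← hmap] at hw
    obtain ⟨x, hx, rfl⟩ := hw
    refine ⟨x, rfl, HeisenbergGroup.x_eq_zero_and_y_eq_zero_of_mem_commutator ?_⟩
    have : (commutator (FreeGroup (Fin 2))).map ((MonoidHom.fst _ _).comp Φ) ≤
        commutator HeisenbergGroup := by
      rw [commutator_def, commutator_def, Subgroup.map_commutator]
      exact Subgroup.commutator_mono le_top le_top
    exact this ⟨x, hx, rfl⟩
  refine ⟨f, ?_, ?_, ?_⟩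
  · intro v hv w hw
    obtain ⟨x, rfl, hx, -⟩ := hlift hv
    obtain ⟨y, rfl, -, -⟩ := hlift hw
    rw [← map_mul, hf, hf, hf, map_mul]
    exact heisenbergCircleDefect_mul_le ℓ _ _ hx
  · intro g w hw
    obtain ⟨x, rfl⟩ := hmk g
    obtain ⟨y, rfl, hy, hy'⟩ := hlift hw
    rw [← map_commutatorElement, hf, map_commutatorElement]
    simpa [hy, hy'] using heisenbergCircleDefect_commutator_sub_le ℓ (Φ x) (Φ y)
  · intro n
    have h : ⁅(PresentedGroup.of 0 : OneRelatorGroup ℓ) ^ n,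
      (PresentedGroup.of 1 : OneRelatorGroup ℓ) ^ ℓ⁆ =
        mk ⁅FreeGroup.of (0 : Fin 2) ^ n, FreeGroup.of (1 : Fin 2) ^ ℓ⁆ := by
      rw [map_commutatorElement, map_pow, map_pow]
      rfl
    rw [h, hf, map_commutatorElement, map_pow, map_pow, hΦ0, hΦ1]
    simpa [HeisenbergGroup.pow_x, HeisenbergGroup.pow_y] using
      heisenbergCircleDefect_commutator_sub_le ℓ
        (((⟨1, 0, 0⟩, A) : HeisenbergGroup × CircleDeg1Liftˣ) ^ n)
        (((⟨0, 1, 0⟩, B) : HeisenbergGroup × CircleDeg1Liftˣ) ^ ℓ)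

/-- If `⁅a, b⁆ ^ ℓ = 1` then `⁅a ^ n, b ^ ℓ⁆` lies in the third term of the lower central
series. -/
theorem commutatorElement_pow_pow_mem {G : Type*} [Group G] {a b : G} {ℓ : ℕ}
    (h : ⁅a, b⁆ ^ ℓ = 1) (n : ℕ) : ⁅a ^ n, b ^ ℓ⁆ ∈ ⁅(⊤ : Subgroup G), commutator G⁆ := by
  let π := QuotientGroup.mk' ⁅(⊤ : Subgroup G), commutator G⁆
  have hc : Commute (π ⁅a, b⁆) (π b) := by
    refine Commute.symm (commutatorElement_eq_one_iff_commute.1 ?_)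
    rw [← map_commutatorElement]
    exact (QuotientGroup.eq_one_iff _).2 (Subgroup.commutator_mem_commutator trivial
      (Subgroup.commutator_mem_commutator trivial trivial))
  have hconj : π a * π b * (π a)⁻¹ = π ⁅a, b⁆ * π b := by
    simp [commutatorElement_def]
  -- Conjugation by `a` turns `b ^ ℓ` into `⁅a, b⁆ ^ ℓ * b ^ ℓ = b ^ ℓ` in the quotient.
  have hab : Commute (π a) (π b ^ ℓ) := by
    have : π a * π b ^ ℓ * (π a)⁻¹ = π b ^ ℓ := by
      rw [← conj_pow, hconj, hc.mul_pow, ← map_pow, h, map_one, one_mul]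
    exact mul_inv_eq_iff_eq_mul.1 this
  refine (QuotientGroup.eq_one_iff _).1 ?_
  change π _ = 1
  rw [map_commutatorElement, map_pow, map_pow, commutatorElement_eq_one_iff_commute]
  exact hab.pow_left n

theorem theorem4p1 (ℓ : ℕ) (hℓ : 2 ≤ ℓ) :
    ¬ SclEquivalent (commutator (OneRelatorGroup ℓ)) := by
  rintro ⟨C, hC, hle⟩
  obtain ⟨f, hD, hK, hf⟩ := exists_quasimorphism_oneRelatorGroup hℓ
  have hℓ' : (0 : ℝ) < ℓ := by exact_mod_cast (by omega : 0 < ℓ)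
  have hrel : ⁅(PresentedGroup.of 0 : OneRelatorGroup ℓ),
      (PresentedGroup.of 1 : OneRelatorGroup ℓ)⁆ ^ ℓ = 1 := by
    change PresentedGroup.mk _ (⁅FreeGroup.of (0 : Fin 2), FreeGroup.of (1 : Fin 2)⁆ ^ ℓ) = 1
    exact (QuotientGroup.eq_one_iff _).2 (Subgroup.subset_normalClosure rfl)
  -- The estimates give `n * ℓ - 3 * ℓ - ℓ ≤ C * (3 * ℓ + ℓ)`, that is `n ≤ 4 + 4 * C`.
  obtain ⟨n, hn⟩ := exists_nat_gt (4 + C * 4)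
  have hmem := commutatorElement_pow_pow_mem hrel n
  have h1 := abs_sub_le_mul_stableMixedCommutatorLength hD hK hmem
  have h2 := (hle _ hmem).trans (mul_le_of_le_one_right hC.le
    (stableCommutatorLength_commutatorElement_le_one _ _))
  have h3 := (abs_le.1 (hf n)).1
  have h4 := le_abs_self
    (f ⁅(PresentedGroup.of 0 : OneRelatorGroup ℓ) ^ n,
      (PresentedGroup.of 1 : OneRelatorGroup ℓ) ^ ℓ⁆)
  have h5 := mul_le_mul_of_nonneg_right h2 (show (0 : ℝ) ≤ ℓ * 3 + ℓ by positivity)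
  have h6 := mul_lt_mul_of_pos_right hn hℓ'
  linarith
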